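/- Let $q$ be a prime power. For subspaces $U,V$ of $\mathbb F_q^n$ put $d_S(U,V)=\dim U+\dim V-2\dim(U\cap V)$. An $(n,d,k)_q$ constant dimension code is a set $\mathscr C$ of $k$-dimensional subspaces of $\mathbb F_q^n$ such that $d=\min\{d_S(U,V) : U,V\in\mathscr C,\ U\ne V\}$. A (linear) $[m\times n,\delta]_q$ MRD code, $1\le\delta\le\min\{m,n\}$, is an $\mathbb F_q$-linear subspace $\mathcal D$ of $\mathbb F_q^{m\times n}$ with $|\mathcal D|=q^{\max\{m,n\}(\min\{m,n\}-\delta+1)}$ and $\operatorname{rank}(A-B)\ge\delta$ for all distinct $A,B\in\mathcal D$. For $n\ge 2k$, the lift of a $[k\times(n-k),\delta]_q$ MRD code $\mathcal D$ is $\{\operatorname{rowspace}(I_k\mid A) : A\in\mathcal D\}$. Let $\overline A_q(n,2\delta,k)$ be the maximum size of an $(n,2\delta,k)_q$ constant dimension code that contains the lift of some $[k\times(n-k),\delta]_q$ MRD code as a subset. Then $$\overline A_q(18,8,6)\ \ge\ q^{36}+q^{24}+q^{20}+2q^{18}+3q^{17}+4q^{16}+q^{15}+q^{14}+2q^{12}+2q^{10}+2q^{8}+q^{7}+q^{6}+2q^{4}+q^{2}+1\quad\text{if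 } q>2,$$ $$\overline A_q(18,8,6)\ \ge\ q^{36}+q^{24}+q^{20}+2q^{18}+3q^{17}+q^{16}+q^{14}+2q^{12}+2q^{10}+2q^{8}+q^{7}+q^{6}+2q^{4}+q^{2}+1\quad\text{if } q=2.$$ -/

import Mathlib

/-- The subspace distance `dim U + dim V - 2 dim (U ∩ V)`; the subtraction never truncates,
because `U ∩ V` is contained in both subspaces. -/
noncomputable def subspaceDist {F : Type*} [Field F] {n : ℕ}
    (U V : Submodule F (Fin n → F)) : ℕ :=
  Module.finrank F U + Module.finrank F V
    - 2 * Module.finrank F (U ⊓ V : Submodule F (Fin n → F))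

/-- `C` is an `(n, d, k)` constant dimension code over `F`: all its elements are `k`-dimensional
subspaces of `F ^ n`, and `d` is the minimum of the subspace distances between distinct elements. -/
structure IsConstantDimensionCode {F : Type*} [Field F] {n : ℕ} (d k : ℕ)
    (C : Set (Submodule F (Fin n → F))) : Prop where
  finrank_eq : ∀ U ∈ C, Module.finrank F U = k
  minDist : IsLeast {e : ℕ | ∃ U ∈ C, ∃ V ∈ C, U ≠ V ∧ e = subspaceDist U V} d

/-- `D` is an `[m × n, δ]` maximum rank distance (MRD) code, linear over `F`: distinct elements
differ by a matrix of rank at least `δ`, and the number of elements attains the Singleton-like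
bound. -/
structure IsLinearMRD {F : Type*} [Field F] {m n : ℕ} (δ : ℕ)
    (D : Submodule F (Matrix (Fin m) (Fin n) F)) : Prop where
  one_le : 1 ≤ δ
  le_min : δ ≤ min m n
  rank_sub : ∀ A ∈ D, ∀ B ∈ D, A ≠ B → δ ≤ (A - B).rank
  card_eq : Nat.card D = Nat.card F ^ (max m n * (min m n - δ + 1))

/-- The block matrix `(I_k | A)`, with `k` rows and `n` columns (meant for `k ≤ n`). -/
def liftMatrix {F : Type*} [Field F] {n k : ℕ} (A : Matrix (Fin k) (Fin (n - k)) F) :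
    Matrix (Fin k) (Fin n) F :=
  Matrix.of fun i j =>
    if h : (j : ℕ) < k then (1 : Matrix (Fin k) (Fin k) F) i ⟨j, h⟩
    else A i ⟨(j : ℕ) - k, by omega⟩

/-- The row space of a matrix. -/
def rowSpace {F : Type*} [Field F] {k n : ℕ} (M : Matrix (Fin k) (Fin n) F) :
    Submodule F (Fin n → F) :=
  Submodule.span F (Set.range M.row)

/-- The lifted code `{rowspace (I_k | A) : A ∈ D}`. -/
def liftedCode {F : Type*} [Field F] {n k : ℕ}
    (D : Submodule F (Matrix (Fin k) (Fin (n - k)) F)) : Set (Submodule F (Fin n → F)) :=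
  {U | ∃ A ∈ D, U = rowSpace (liftMatrix A)}

/-- The sizes of the `(n, 2δ, k)` constant dimension codes over `F` that contain a lifted MRD code
(the lift of a `[k × (n - k), δ]` MRD code) as a subset. -/
def sizesWithLiftedMRD (F : Type*) [Field F] (n d k : ℕ) : Set ℕ :=
  {M | ∃ C : Set (Submodule F (Fin n → F)),
    IsConstantDimensionCode d k C ∧
    (∃ (δ : ℕ) (D : Submodule F (Matrix (Fin k) (Fin (n - k)) F)),
      d = 2 * δ ∧ IsLinearMRD δ D ∧ liftedCode D ⊆ C) ∧
    C.ncard = M}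

/-- Over a finite field these sizes are bounded, so that a supremum of them is a maximum as soon
as one such code exists. -/
theorem bddAbove_sizesWithLiftedMRD (F : Type*) [Field F] [Finite F] (n d k : ℕ) :
    BddAbove (sizesWithLiftedMRD F n d k) := by
  have : Finite (Submodule F (Fin n → F)) :=
    Finite.of_injective (fun U => (U : Set (Fin n → F))) SetLike.coe_injective
  refine ⟨Nat.card (Submodule F (Fin n → F)), ?_⟩
  rintro M ⟨C, -, -, rfl⟩
  exact Set.ncard_le_card C

/-- `Ā_q(n, d, k)` for `q = |F|`: the maximum size of an `(n, d, k)` constant dimension code over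
`F` that contains a lifted MRD code as a subset. -/
noncomputable def Abar (F : Type*) [Field F] (n d k : ℕ) : ℕ :=
  sSup (sizesWithLiftedMRD F n d k)

/-! Work in `F ^ 6 × F ^ 12`. Distance `8` between `6`-dimensional spaces means intersections of
dimension at most `2`. The graphs of the matrices of a `[6 × 12, 4]` MRD code give the lifted part,
of size `q ^ 36`. Every added codeword projects onto a `2`-dimensional subspace of `F ^ 6`. A graph
projects injectively, so it meets an added codeword in dimension at most `2`, and only the added
codewords have to be compared with each other.

An added codeword is the row space of `(W | N₁)` over `(0 | N₂)`, where `W` spans an element of a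
Desarguesian line spread of `F ^ 6`, with `q ^ 4 + q ^ 2 + 1` elements, and `N₂` is in reduced
echelon form with four pivots among twelve columns. For different spread elements the intersection
lies in `0 × F ^ 12`, and its leading positions are common pivots, so two pivot sets meeting in at
most two points suffice (`finrank_inf_blockMap_le_card`). For the same spread element, disjoint
pivot sets suffice (`finrank_inf_blockMap_of_disjoint`). For equal spread element and pivots,
matrices at rank distance at least `4` suffice (`exists_ferrersCode`).

The pivot sets are blocks of `S(3, 4, 8)` and four more quadruples; complementary blocks share a
spread element. The block `{4, 5, 6, 7}` is treated separately: it is used with many spread elements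
at once, parametrised by `z`, and the loss of rank as `z` and `y` vary is compensated by the spread
and by entries left of the pivots (`middleMatrix_inter_bounds`). It contributes `|Z| * q ^ 8`
codewords. -/

open Matrix

/-! ### Linearized polynomials and their kernels -/

/-- The `q`-polynomial `∑ i, a i * x ^ (q ^ i)` as an `F`-linear map, where `q = |F|`. -/
noncomputable def qPoly (F L : Type*) [Field F] [Fintype F] [Field L] [Algebra F L] (K : ℕ) :
    (Fin K → L) →ₗ[F] (L →ₗ[F] L) where
  toFun a := ∑ i : Fin K,
    LinearMap.mulLeft F (a i) ∘ₗ ((FiniteField.frobeniusAlgHom F L) ^ (i : ℕ)).toLinearMap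
  map_add' a b := by
    ext x
    simp [add_mul, Finset.sum_add_distrib]
  map_smul' c a := by
    ext x
    simp [Finset.smul_sum]

theorem qPoly_apply {F L : Type*} [Field F] [Fintype F] [Field L] [Algebra F L] {K : ℕ}
    (a : Fin K → L) (x : L) :
    qPoly F L K a x = ∑ i : Fin K, a i * x ^ (Fintype.card F ^ (i : ℕ)) := by
  simp [qPoly, AlgHom.coe_pow, FiniteField.coe_frobeniusAlgHom, pow_iterate]

/-- A nonzero `q`-polynomial with `K` coefficients has at most `q ^ (K - 1)` roots. -/
theorem finrank_ker_qPoly_lt {F L : Type*} [Field F] [Fintype F] [Field L] [Algebra F L]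
    [Finite L] {K : ℕ} {a : Fin K → L} (ha : a ≠ 0) :
    Module.finrank F (LinearMap.ker (qPoly F L K a)) < K := by
  classical
  have hq : 1 < Fintype.card F := Fintype.one_lt_card
  obtain ⟨i₀, hi₀⟩ : ∃ i, a i ≠ 0 := by
    by_contra! h
    exact ha (funext h)
  have hK : 0 < K := i₀.pos
  let f : Polynomial L :=
    ∑ i : Fin K, Polynomial.C (a i) * Polynomial.X ^ (Fintype.card F ^ (i : ℕ))
  -- The exponents `q ^ i` are distinct, so a nonzero coefficient of `a` survives in `f`.
  have hf : f ≠ 0 := by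
    intro h
    have h1 := congrArg (fun p => Polynomial.coeff p (Fintype.card F ^ (i₀ : ℕ))) h
    simp only [f, Polynomial.finsetSum_coeff, Polynomial.coeff_C_mul, Polynomial.coeff_X_pow,
      Polynomial.coeff_zero] at h1
    rw [Finset.sum_eq_single i₀] at h1
    · simp at h1
      exact hi₀ h1
    · intro j _ hj
      rw [if_neg, mul_zero]
      intro h2
      exact hj (Fin.ext (Nat.pow_right_injective hq h2).symm)
    · simp
  have hdeg : f.natDegree ≤ Fintype.card F ^ (K - 1) := by
    refine Polynomial.natDegree_sum_le_of_forall_le _ _ fun i _ => ?_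
    refine (Polynomial.natDegree_C_mul_X_pow_le _ _).trans ?_
    exact Nat.pow_le_pow_right hq.le (by omega)
  have hroot : ∀ x : LinearMap.ker (qPoly F L K a), (x : L) ∈ f.roots.toFinset := by
    intro x
    have hx : qPoly F L K a x = 0 := x.2
    rw [qPoly_apply] at hx
    simpa [hf, f, Polynomial.eval_finsetSum, Polynomial.IsRoot] using hx
  have hcard : Nat.card (LinearMap.ker (qPoly F L K a)) ≤ Fintype.card F ^ (K - 1) := by
    refine le_trans ?_ ((Multiset.toFinset_card_le _).trans ((Polynomial.card_roots' f).trans hdeg))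
    have h := Nat.card_le_card_of_injective
      (fun x : LinearMap.ker (qPoly F L K a) => (⟨x, hroot x⟩ : f.roots.toFinset))
      (fun x y hxy => Subtype.ext (congrArg (fun z : f.roots.toFinset => (z : L)) hxy))
    rwa [Nat.card_eq_fintype_card (α := f.roots.toFinset), Fintype.card_coe] at h
  rw [Module.natCard_eq_pow_finrank (K := F), Nat.card_eq_fintype_card] at hcard
  have := (Nat.pow_le_pow_iff_right hq).1 hcard
  omega

/-- The dependencies between the values of a nonzero `q`-polynomial with `K` coefficients at
linearly independent points form a space of dimension less than `K`. -/
theorem finrank_lt_of_forall_sum_qPoly_eq_zero {F L σ : Type*} [Field F] [Fintype F] [Field L]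
    [Algebra F L] [Finite L] [Fintype σ] {K : ℕ} {a : Fin K → L} (ha : a ≠ 0) {h : σ → L}
    (hh : LinearIndependent F h) (N : Submodule F (σ → F))
    (hN : ∀ c ∈ N, ∑ r, c r • qPoly F L K a (h r) = 0) : Module.finrank F N < K := by
  refine lt_of_le_of_lt ?_ (finrank_ker_qPoly_lt (F := F) ha)
  have : Module.Finite F L := Module.Finite.of_finite
  let φ : N →ₗ[F] LinearMap.ker (qPoly F L K a) :=
    ((Fintype.linearCombination F h) ∘ₗ N.subtype).codRestrict _ fun c => by
      have := hN c c.2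
      simpa [Fintype.linearCombination_apply, map_sum] using this
  refine LinearMap.finrank_le_finrank_of_injective (f := φ) ?_
  intro x y hxy
  have h1 : Fintype.linearCombination F h x = Fintype.linearCombination F h y :=
    congrArg Subtype.val hxy
  exact Subtype.ext (hh.fintypeLinearCombination_injective h1)

/-! ### Gabidulin codes with prescribed supports -/

theorem natCard_repr_support {F L ι : Type*} [Field F] [Finite F] [AddCommGroup L] [Module F L]
    {Q : Finset ι} (b : Module.Basis Q F L) {s : Finset ι} (hs : s ⊆ Q) :
    Nat.card {x : L // ∀ c : Q, (c : ι) ∉ s → b.repr x c = 0} = Nat.card F ^ s.card := by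
  classical
  have e : {x : L // ∀ c : Q, (c : ι) ∉ s → b.repr x c = 0} ≃ (s → F) :=
    { toFun := fun x c => b.repr x ⟨c, hs c.2⟩
      invFun := fun y => ⟨b.equivFun.symm fun c => if h : (c : ι) ∈ s then y ⟨c, h⟩ else 0, by
        intro c hc
        rw [← Module.Basis.equivFun_apply, LinearEquiv.apply_symm_apply, dif_neg hc]⟩
      left_inv := by
        intro x
        apply Subtype.ext
        apply b.equivFun.injective
        ext c
        simp only [LinearEquiv.apply_symm_apply]
        by_cases hc : (c : ι) ∈ s
        · rw [dif_pos hc, Module.Basis.equivFun_apply]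
        · rw [dif_neg hc, Module.Basis.equivFun_apply, x.2 c hc]
      right_inv := by
        intro y
        ext c
        simp only [← Module.Basis.equivFun_apply, LinearEquiv.apply_symm_apply]
        rw [dif_pos c.2] }
  rw [Nat.card_congr e, Nat.card_fun]
  simp

/-- **Gabidulin codes with prescribed supports.** -/
theorem exists_rankCode {F ρ ι : Type*} [Field F] [Finite F] [Fintype ρ] [Fintype ι]
    (Q : Finset ι) (hρ : Fintype.card ρ ≤ Q.card) (R : Finset ρ) (hR : R.Nonempty)
    (s : ρ → Finset ι) (hs : ∀ r, s r ⊆ Q) (hs' : ∀ r ∉ R, s r = Q) :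
    ∃ D : Submodule F (Matrix ρ ι F),
      (∀ M ∈ D, M ≠ 0 → Module.finrank F (LinearMap.ker M.vecMulLinear) < R.card) ∧
      (∀ M ∈ D, ∀ r, ∀ c ∉ s r, M r c = 0) ∧
      Nat.card D = Nat.card F ^ ∑ r ∈ R, (s r).card := by
  classical
  have := Fintype.ofFinite F
  obtain ⟨p, hp⟩ := CharP.exists F
  have : Fact p.Prime := ⟨CharP.char_is_prime F p⟩
  have hQ : Q.card ≠ 0 := by
    obtain ⟨r, -⟩ := hR
    have : 0 < Fintype.card ρ := Fintype.card_pos_iff.2 ⟨r⟩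
    omega
  have : NeZero Q.card := ⟨hQ⟩
  let L := FiniteField.Extension F p Q.card
  have hL : Module.finrank F L = Q.card := FiniteField.finrank_extension F p _
  have : Finite L := Module.finite_of_finite F
  let b : Module.Basis Q F L := (Module.finBasisOfFinrankEq F L hL).reindex Q.equivFin.symm
  obtain ⟨e⟩ : Nonempty (ρ ↪ Q) := by
    rw [Function.Embedding.nonempty_iff_card_le]
    simpa using hρ
  let g : ρ → L := fun r => b (e r)
  have hg : LinearIndependent F g := b.linearIndependent.comp _ e.injective
  -- Interpolation: a `q`-polynomial with `|R|` coefficients is determined by its values at the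
  -- `|R|` independent points of `R`, and these values are arbitrary. Hence supports can be imposed
  -- freely on the rows in `R`, while the other rows are then forced.
  let ev : (Fin R.card → L) →ₗ[F] (R → L) :=
    LinearMap.pi fun r => (LinearMap.applyₗ (g r)) ∘ₗ qPoly F L R.card
  have ev_apply : ∀ a r, ev a r = qPoly F L R.card a (g r) := fun a r => rfl
  have hinj : Function.Injective ev := by
    rw [← LinearMap.ker_eq_bot, LinearMap.ker_eq_bot']
    intro a ha
    by_contra hne
    have := finrank_lt_of_forall_sum_qPoly_eq_zero hne
      (hg.comp (fun r : R => (r : ρ)) Subtype.val_injective) ⊤ (fun c _ => by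
        refine Finset.sum_eq_zero fun r _ => ?_
        have h1 : ev a r = 0 := by rw [ha]; rfl
        rw [ev_apply] at h1
        simp [h1])
    simp at this
  have : Module.Finite F L := Module.Finite.of_finite
  have hsurj : Function.Surjective ev := by
    rw [← LinearMap.injective_iff_surjective_of_finrank_eq_finrank]
    · exact hinj
    · simp [Module.finrank_pi_fintype]
  let mat : (Fin R.card → L) →ₗ[F] Matrix ρ ι F :=
    { toFun := fun a => Matrix.of fun r c =>
        if h : c ∈ Q then b.repr (qPoly F L R.card a (g r)) ⟨c, h⟩ else 0
      map_add' := fun x y => by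
        ext r c
        by_cases h : c ∈ Q <;> simp [h]
      map_smul' := fun x y => by
        ext r c
        by_cases h : c ∈ Q <;> simp [h] }
  have mat_mem : ∀ a r (c : Q), mat a r c = b.repr (qPoly F L R.card a (g r)) c := by
    intro a r c
    simp [mat]
  have mat_not_mem : ∀ a r, ∀ c ∉ Q, mat a r c = 0 := by
    intro a r c hc
    simp [mat, hc]
  have hmat : Function.Injective mat := by
    intro x y hxy
    apply hinj
    ext r
    rw [ev_apply, ev_apply]
    apply b.repr.injective
    ext c
    rw [← mat_mem, ← mat_mem, hxy]
  let A : Submodule F (Fin R.card → L) :=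
    { carrier := {a | ∀ r : R, ∀ c : Q, (c : ι) ∉ s r → b.repr (ev a r) c = 0}
      add_mem' := fun {x y} hx hy r c hc => by simp [hx r c hc, hy r c hc]
      zero_mem' := fun r c _ => by simp
      smul_mem' := fun t x hx r c hc => by simp [hx r c hc] }
  refine ⟨A.map mat, ?_, ?_, ?_⟩
  · rintro _ ⟨a, ha, rfl⟩ hne
    refine finrank_lt_of_forall_sum_qPoly_eq_zero (a := a) ?_ hg _ ?_
    · rintro rfl
      simp at hne
    · intro c hc
      have hc' : c ᵥ* mat a = 0 := hc
      apply b.repr.injective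
      ext j
      have h1 := congrFun hc' j
      simp only [Matrix.vecMul, dotProduct, Pi.zero_apply] at h1
      simp only [map_sum, map_smul, Finsupp.coe_finsetSum, Finset.sum_apply, Finsupp.smul_apply,
        map_zero, Finsupp.coe_zero, Pi.zero_apply, smul_eq_mul]
      simpa [mat_mem] using h1
  · rintro _ ⟨a, ha, rfl⟩ r c hc
    by_cases hcQ : c ∈ Q
    · by_cases hr : r ∈ R
      · exact (mat_mem a r ⟨c, hcQ⟩).trans (ha ⟨r, hr⟩ ⟨c, hcQ⟩ hc)
      · exact absurd (hs' r hr ▸ hcQ) hc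
    · exact mat_not_mem a r c hcQ
  · rw [← Nat.card_congr (Submodule.equivMapOfInjective mat hmat A).toEquiv]
    let e1 : A ≃ {h : R → L // ∀ r : R, ∀ c : Q, (c : ι) ∉ s r → b.repr (h r) c = 0} :=
      (Equiv.ofBijective ev ⟨hinj, hsurj⟩).subtypeEquiv fun a => Iff.rfl
    rw [Nat.card_congr e1, Nat.card_congr (Equiv.subtypePiEquivPi
      (p := fun (r : R) (x : L) => ∀ c : Q, (c : ι) ∉ s r → b.repr x c = 0)), Nat.card_pi]
    rw [Finset.prod_congr rfl fun (r : R) _ => natCard_repr_support b (hs (r : ρ)),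
      Finset.prod_pow_eq_pow_sum,
      Finset.sum_coe_sort R fun r => (s r).card]

/-! ### Intersections of codewords in echelon form -/

/-- The rows indexed by `β` are in reduced echelon form with pivots `P`, and the rows indexed by
`α` vanish at the pivots. -/
structure IsEchelon {F α β κ : Type*} [Field F] [LT κ] [DecidableEq β] (P : β → κ)
    (N : Matrix (α ⊕ β) κ F) : Prop where
  pivot : ∀ i j, N (Sum.inr i) (P j) = if i = j then 1 else 0
  above : ∀ i j, N (Sum.inl i) (P j) = 0
  left : ∀ i, ∀ c < P i, N (Sum.inr i) c = 0

/-- The linear map whose range is the row space of the matrix with block rows `(W | N₁)` and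
`(0 | N₂)`, where `N₁` and `N₂` are the parts of `N` indexed by `α` and `β`. -/
def blockMap {F α β κ V : Type*} [Field F] [Fintype α] [Fintype β] [AddCommGroup V] [Module F V]
    (W : (α → F) →ₗ[F] V) (N : Matrix (α ⊕ β) κ F) : (α ⊕ β → F) →ₗ[F] V × (κ → F) :=
  (W ∘ₗ LinearMap.funLeft F F Sum.inl).prod N.vecMulLinear

section Echelon

variable {F α β κ V : Type*} [Field F] [Fintype α] [Fintype β] [DecidableEq β] [LinearOrder κ]
  [AddCommGroup V] [Module F V]

omit [DecidableEq β] [LinearOrder κ] in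
theorem blockMap_apply (W : (α → F) →ₗ[F] V) (N : Matrix (α ⊕ β) κ F) (c : α ⊕ β → F) :
    blockMap W N c = (W fun i => c (Sum.inl i), c ᵥ* N) := rfl

theorem IsEchelon.vecMul_pivot {P : β → κ} {N : Matrix (α ⊕ β) κ F} (hN : IsEchelon P N)
    (c : α ⊕ β → F) (j : β) : (c ᵥ* N) (P j) = c (Sum.inr j) := by
  simp [Matrix.vecMul, dotProduct, Fintype.sum_sum_type, hN.pivot, hN.above]

/-- The leading position of a nonzero combination of the echelon rows is a pivot. -/
theorem IsEchelon.exists_leading {P : β → κ} {N : Matrix (α ⊕ β) κ F} (hN : IsEchelon P N)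
    {c : α ⊕ β → F} (hc : ∀ i, c (Sum.inl i) = 0) (hne : c ≠ 0) :
    ∃ j, (c ᵥ* N) (P j) ≠ 0 ∧ ∀ x < P j, (c ᵥ* N) x = 0 := by
  classical
  have hS : (Finset.univ.filter fun j => c (Sum.inr j) ≠ 0).Nonempty := by
    by_contra h
    rw [Finset.not_nonempty_iff_eq_empty, Finset.filter_eq_empty_iff] at h
    refine hne (funext fun x => ?_)
    rcases x with i | j
    · exact hc i
    · simpa using h (Finset.mem_univ j)
  obtain ⟨j, hj, hmin⟩ := Finset.exists_min_image _ P hS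
  simp only [Finset.mem_filter, Finset.mem_univ, true_and] at hj hmin
  refine ⟨j, by rwa [hN.vecMul_pivot], fun x hx => ?_⟩
  refine Finset.sum_eq_zero fun i _ => ?_
  rcases i with i | i
  · simp [hc i]
  · by_cases hi : c (Sum.inr i) = 0
    · simp [hi]
    · simp [hN.left i x (hx.trans_le (hmin i hi))]

theorem blockMap_injective {P : β → κ} {N : Matrix (α ⊕ β) κ F} (hN : IsEchelon P N)
    {W : (α → F) →ₗ[F] V} (hW : Function.Injective W) : Function.Injective (blockMap W N) := by
  intro c d h
  simp only [blockMap_apply, Prod.mk.injEq] at h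
  funext x
  rcases x with i | j
  · exact congrFun (hW h.1) i
  · rw [← hN.vecMul_pivot c j, h.2, hN.vecMul_pivot]

/-- Two combinations of echelon rows agree only if they vanish, as soon as they vanish at the
common pivots. -/
theorem IsEchelon.vecMul_eq_zero {P P' : β → κ} {N N' : Matrix (α ⊕ β) κ F} (hN : IsEchelon P N)
    (hN' : IsEchelon P' N') {c d : α ⊕ β → F} (hc : ∀ i, c (Sum.inl i) = 0)
    (hd : ∀ i, d (Sum.inl i) = 0) (hcd : c ᵥ* N = d ᵥ* N')
    (hJ : ∀ i j, P i = P' j → (c ᵥ* N) (P i) = 0) : c ᵥ* N = 0 := by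
  by_contra hne
  obtain ⟨i, hi, hi'⟩ := hN.exists_leading hc (by rintro rfl; simp at hne)
  obtain ⟨j, hj, hj'⟩ := hN'.exists_leading hd (by rintro rfl; simp [hcd] at hne)
  rw [← hcd] at hj hj'
  rcases lt_trichotomy (P i) (P' j) with h | h | h
  · exact hi (hj' _ h)
  · exact hi (hJ i j h)
  · exact hj (hi' _ h)

/-- The pivot coordinates of a common vector are its coefficients on the `β` rows, so equal pivots
force the two coefficient vectors to agree there. -/
theorem finrank_inf_blockMap_same [Finite κ] {P : β → κ} {N N' : Matrix (α ⊕ β) κ F}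
    (hN : IsEchelon P N) (hN' : IsEchelon P N') {W W' : (α → F) →ₗ[F] V}
    (Y : Submodule F (α ⊕ β → F))
    (hY : ∀ c d, W (fun i => c (Sum.inl i)) = W' (fun i => d (Sum.inl i)) →
      (∀ j, c (Sum.inr j) = d (Sum.inr j)) → c ᵥ* N = d ᵥ* N' → c ∈ Y) :
    Module.finrank F ((LinearMap.range (blockMap W N) ⊓ LinearMap.range (blockMap W' N') :
      Submodule F (V × (κ → F)))) ≤ Module.finrank F Y := by
  refine le_trans (Submodule.finrank_mono (t := Y.map (blockMap W N)) ?_)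
    (Submodule.finrank_map_le _ _)
  rintro x ⟨⟨c, rfl⟩, ⟨d, hd⟩⟩
  simp only [blockMap_apply, Prod.mk.injEq] at hd
  refine ⟨c, hY c d hd.1.symm (fun j => ?_) hd.2.symm, rfl⟩
  rw [← hN.vecMul_pivot c j, ← hd.2, hN'.vecMul_pivot]

/-- Trivially meeting images of `W` and `W'` kill the `α` coefficients. What remains is a
combination of echelon rows on both sides, so its leading position is a common pivot and its
coordinates in `J` determine it. -/
theorem finrank_inf_blockMap_le_card [Finite κ] {P P' : β → κ} {N N' : Matrix (α ⊕ β) κ F}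
    (hN : IsEchelon P N) (hN' : IsEchelon P' N') {W W' : (α → F) →ₗ[F] V}
    (hW : ∀ a b, W a = W' b → a = 0 ∧ b = 0) (J : Finset κ) (hJ : ∀ i j, P i = P' j → P i ∈ J) :
    Module.finrank F ((LinearMap.range (blockMap W N) ⊓ LinearMap.range (blockMap W' N') :
      Submodule F (V × (κ → F)))) ≤ J.card := by
  let φ : (LinearMap.range (blockMap W N) ⊓ LinearMap.range (blockMap W' N') :
      Submodule F (V × (κ → F))) →ₗ[F] (J → F) :=
    LinearMap.funLeft F F (fun x : J => (x : κ)) ∘ₗ LinearMap.snd F V (κ → F) ∘ₗ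
      Submodule.subtype _
  have hφ : Function.Injective φ := by
    rw [← LinearMap.ker_eq_bot, LinearMap.ker_eq_bot']
    rintro ⟨x, ⟨c, rfl⟩, ⟨d, hd⟩⟩ hx
    simp only [blockMap_apply, Prod.mk.injEq] at hd
    obtain ⟨hd0, hc0⟩ := hW _ _ hd.1.symm
    have h0 : c ᵥ* N = 0 := hN.vecMul_eq_zero hN' (congrFun hd0) (congrFun hc0) hd.2.symm
      fun i j hij => congrFun hx ⟨P i, hJ i j hij⟩
    apply Subtype.ext
    simp [blockMap_apply, h0, hd0]
  simpa using LinearMap.finrank_le_finrank_of_injective hφ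

theorem finrank_le_card_of_fst {M : Type*} [AddCommGroup M] [Module F M]
    (W : (α → F) →ₗ[F] V) (X : Submodule F (V × M))
    (hX : ∀ x ∈ X, x.1 ∈ LinearMap.range W) (hX' : ∀ x ∈ X, x.1 = 0 → x = 0) :
    Module.finrank F X ≤ Fintype.card α := by
  let φ : X →ₗ[F] LinearMap.range W :=
    (LinearMap.fst F V M ∘ₗ X.subtype).codRestrict _ fun x => hX x x.2
  have hφ : Function.Injective φ := by
    rw [← LinearMap.ker_eq_bot, LinearMap.ker_eq_bot']
    intro x hx
    exact Subtype.ext (hX' x x.2 (congrArg Subtype.val hx))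
  refine (LinearMap.finrank_le_finrank_of_injective hφ).trans ?_
  simpa using LinearMap.finrank_range_le W

/-- A common vector with zero first component would have a leading position that is a pivot of both
matrices; hence projection to the range of `W` is injective on the intersection. -/
theorem finrank_inf_blockMap_of_disjoint {P P' : β → κ} {N N' : Matrix (α ⊕ β) κ F}
    (hN : IsEchelon P N) (hN' : IsEchelon P' N') {W W' : (α → F) →ₗ[F] V}
    (hW : Function.Injective W) (hW' : Function.Injective W') (hJ : ∀ i j, P i ≠ P' j) :
    Module.finrank F ((LinearMap.range (blockMap W N) ⊓ LinearMap.range (blockMap W' N') :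
      Submodule F (V × (κ → F)))) ≤ Fintype.card α := by
  refine finrank_le_card_of_fst W _ ?_ ?_
  · rintro x ⟨⟨c, rfl⟩, -⟩
    exact ⟨_, rfl⟩
  · rintro x ⟨⟨c, rfl⟩, ⟨d, hd⟩⟩ hx
    simp only [blockMap_apply, Prod.mk.injEq] at hd hx
    have hc0 : (fun i => c (Sum.inl i)) = 0 := hW (by rw [hx, map_zero])
    have hd0 : (fun i => d (Sum.inl i)) = 0 := hW' (by rw [hd.1, hx, map_zero])
    have h0 : c ᵥ* N = 0 := hN.vecMul_eq_zero hN' (congrFun hc0) (congrFun hd0) hd.2.symm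
      fun i j hij => absurd hij (hJ i j)
    simp [blockMap_apply, h0, hc0]

end Echelon

/-! ### Graphs of matrices: the lifted code -/

/-- The graph `{(a, a A)}` of a matrix, which is the row space of `(I | A)`. -/
def graphMap {F ρ κ : Type*} [Field F] [Fintype ρ] (A : Matrix ρ κ F) :
    (ρ → F) →ₗ[F] (ρ → F) × (κ → F) :=
  LinearMap.id.prod A.vecMulLinear

section Graph

variable {F ρ κ : Type*} [Field F] [Fintype ρ]

theorem graphMap_apply (A : Matrix ρ κ F) (c : ρ → F) : graphMap A c = (c, c ᵥ* A) := rfl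

theorem graphMap_injective (A : Matrix ρ κ F) : Function.Injective (graphMap A) :=
  fun _ _ h => congrArg Prod.fst h

theorem finrank_inf_graphMap_le [Finite κ] (A B : Matrix ρ κ F) :
    Module.finrank F (LinearMap.range (graphMap A) ⊓ LinearMap.range (graphMap B) :
      Submodule F ((ρ → F) × (κ → F))) ≤
      Module.finrank F (LinearMap.ker (A - B).vecMulLinear) := by
  refine le_trans (Submodule.finrank_mono
    (t := (LinearMap.ker (A - B).vecMulLinear).map (graphMap A)) ?_) (Submodule.finrank_map_le _ _)
  rintro x ⟨⟨c, rfl⟩, ⟨d, hd⟩⟩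
  simp only [graphMap_apply, Prod.mk.injEq] at hd
  obtain ⟨rfl, hd⟩ := hd
  refine ⟨d, ?_, rfl⟩
  simp [hd]

theorem finrank_inf_graphMap_blockMap_le {α β : Type*} [Fintype α] [Fintype β]
    (A : Matrix ρ κ F) (W : (α → F) →ₗ[F] (ρ → F)) (N : Matrix (α ⊕ β) κ F) :
    Module.finrank F (LinearMap.range (graphMap A) ⊓ LinearMap.range (blockMap W N) :
      Submodule F ((ρ → F) × (κ → F))) ≤ Fintype.card α := by
  refine finrank_le_card_of_fst W _ ?_ ?_
  · rintro x ⟨-, ⟨c, rfl⟩⟩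
    exact ⟨_, rfl⟩
  · rintro x ⟨⟨c, rfl⟩, -⟩ (hx : c = 0)
    simp [hx]

end Graph

/-! ### Spreads -/

/-- A Desarguesian spread: `∑ i < m, (q ^ r) ^ i` subspaces of dimension `r` in a space of
dimension `r * m`, with pairwise trivial intersection. -/
theorem exists_spread (F V : Type*) [Field F] [Finite F] [AddCommGroup V] [Module F V]
    {r m : ℕ} (hr : r ≠ 0) (hm : m ≠ 0) (hV : Module.finrank F V = r * m) :
    ∃ W : Fin (∑ i ∈ Finset.range m, (Nat.card F ^ r) ^ i) → ((Fin r → F) →ₗ[F] V),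
      (∀ t, Function.Injective (W t)) ∧
      ∀ t s, t ≠ s → ∀ a b, W t a = W s b → a = 0 ∧ b = 0 := by
  obtain ⟨p, hp⟩ := CharP.exists F
  have : Fact p.Prime := ⟨CharP.char_is_prime F p⟩
  have : NeZero r := ⟨hr⟩
  let L := FiniteField.Extension F p r
  have hL : Module.finrank F L = r := FiniteField.finrank_extension F p r
  have : Finite L := Module.finite_of_finite F
  have : Module.Finite F L := Module.Finite.of_finite
  have : Module.Finite F V := Module.finite_of_finrank_pos (by rw [hV]; positivity)
  have hcard : Nat.card (Projectivization L (Fin m → L)) = ∑ i ∈ Finset.range m, (Nat.card F ^ r) ^ i := by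
    rw [Projectivization.card_of_finrank L (Fin m → L) (n := m) (by simp),
      Module.natCard_eq_pow_finrank (K := F) (V := L), hL]
  have : Finite (Projectivization L (Fin m → L)) := inferInstance
  let pt : Fin (∑ i ∈ Finset.range m, (Nat.card F ^ r) ^ i) ≃ Projectivization L (Fin m → L) :=
    (finCongr hcard.symm).trans (Finite.equivFin _).symm
  let e1 : (Fin r → F) ≃ₗ[F] L := LinearEquiv.ofFinrankEq _ _ (by simp [hL])
  let e2 : (Fin m → L) ≃ₗ[F] V :=
    LinearEquiv.ofFinrankEq _ _ (by simp [Module.finrank_pi_fintype, hL, hV, mul_comm])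
  let W : Fin (∑ i ∈ Finset.range m, (Nat.card F ^ r) ^ i) → ((Fin r → F) →ₗ[F] V) := fun t =>
    e2.toLinearMap ∘ₗ ((LinearMap.toSpanSingleton L (Fin m → L) (pt t).rep).restrictScalars F) ∘ₗ
      e1.toLinearMap
  have hWa : ∀ t a, W t a = e2 (e1 a • (pt t).rep) := fun t a => rfl
  have hinj : ∀ t, Function.Injective (W t) := by
    intro t a b hab
    rw [hWa, hWa] at hab
    exact e1.injective (smul_left_injective L (pt t).rep_nonzero (e2.injective hab))
  refine ⟨W, hinj, ?_⟩
  intro t s hts a b hab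
  have ha : a = 0 := by
    by_contra hne
    -- A shared nonzero vector makes the two representatives proportional over `L`, hence the
    -- projective points equal.
    refine hts (pt.injective ?_)
    have h := hab
    rw [hWa, hWa] at h
    have h := e2.injective h
    rw [← (pt t).mk_rep, ← (pt s).mk_rep]
    rw [Projectivization.mk_eq_mk_iff']
    have h1 : e1 a ≠ 0 := by simpa using hne
    exact ⟨(e1 a)⁻¹ * e1 b, by rw [mul_smul, ← h, smul_smul, inv_mul_cancel₀ h1, one_smul]⟩
  refine ⟨ha, hinj s ?_⟩
  rw [← hab, ha, map_zero]
  exact (map_zero (W s)).symm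

/-! ### Nested rank-metric codes and Ferrers diagram codes -/

/-- Square matrices from `q`-polynomials: the rank grows when the top coefficients vanish. -/
theorem exists_flagCode (F : Type*) [Field F] [Finite F] (n K : ℕ) [NeZero n] :
    ∃ A : (Fin K → Fin n → F) →ₗ[F] Matrix (Fin n) (Fin n) F,
      ∀ a ≠ 0, ∀ k : ℕ, k ≤ K → (∀ i : Fin K, k ≤ i → a i = 0) →
        Module.finrank F (LinearMap.ker (A a).vecMulLinear) < k := by
  have := Fintype.ofFinite F
  obtain ⟨p, hp⟩ := CharP.exists F
  have : Fact p.Prime := ⟨CharP.char_is_prime F p⟩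
  let L := FiniteField.Extension F p n
  have hL : Module.finrank F L = n := FiniteField.finrank_extension F p n
  have : Finite L := Module.finite_of_finite F
  let b : Module.Basis (Fin n) F L := Module.finBasisOfFinrankEq F L hL
  let e : (Fin n → F) ≃ₗ[F] L := b.equivFun.symm
  let A : (Fin K → Fin n → F) →ₗ[F] Matrix (Fin n) (Fin n) F :=
    { toFun := fun a => Matrix.of fun r c =>
        b.equivFun (qPoly F L K (fun i => e (a i)) (b r)) c
      map_add' := fun x y => by
        have : (fun i => e ((x + y) i)) = (fun i => e (x i)) + fun i => e (y i) := by
          ext i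
          simp
        ext r c
        rw [Matrix.add_apply, Matrix.of_apply, this, map_add, LinearMap.add_apply, map_add]
        rfl
      map_smul' := fun t x => by
        have : (fun i => e ((t • x) i)) = t • fun i => e (x i) := by
          ext i
          simp
        ext r c
        rw [Matrix.smul_apply, Matrix.of_apply, this, map_smul, LinearMap.smul_apply, map_smul]
        rfl }
  refine ⟨A, fun a ha k hk hak => ?_⟩
  let a' : Fin k → L := fun i => e (a (Fin.castLE hk i))
  have ha' : a' ≠ 0 := by
    intro h
    refine ha (funext fun i => ?_)
    by_cases hi : (i : ℕ) < k
    · exact e.injective ((congrFun h ⟨i, hi⟩).trans (map_zero e).symm)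
    · exact hak i (not_lt.1 hi)
  have hpoly : qPoly F L K (fun i => e (a i)) = qPoly F L k a' := by
    ext x
    rw [qPoly_apply, qPoly_apply]
    obtain ⟨l, rfl⟩ := Nat.exists_eq_add_of_le hk
    rw [Fin.sum_univ_add]
    have : ∀ i : Fin l, a (Fin.natAdd k i) = 0 := fun i => hak _ (by simp)
    simp only [this, map_zero, zero_mul, Finset.sum_const_zero, add_zero]
    rfl
  refine finrank_lt_of_forall_sum_qPoly_eq_zero ha' b.linearIndependent _ fun c hc => ?_
  have hc' : c ᵥ* A a = 0 := hc
  apply b.equivFun.injective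
  ext j
  have h1 := congrFun hc' j
  rw [← hpoly]
  simp only [Matrix.vecMul, dotProduct, Pi.zero_apply] at h1
  simp only [map_sum, map_smul, Finset.sum_apply, Pi.smul_apply, map_zero, Pi.zero_apply,
    smul_eq_mul]
  exact h1

/-- The matrix whose rows indexed by `β` are the unit vectors at the pivots. -/
def pivotMatrix (F : Type*) [Field F] (α : Type*) {β κ : Type*} [DecidableEq κ] (P : β → κ) :
    Matrix (α ⊕ β) κ F :=
  Matrix.of (Sum.elim (fun _ _ => 0) fun j c => if P j = c then 1 else 0)

/-- The positions of an echelon matrix with pivots `P` that may be filled arbitrarily, in the row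
with pivot `P j`. -/
def freePositions {β κ : Type*} [Fintype β] [Fintype κ] [LinearOrder κ] (P : β → κ) (j : β) :
    Finset κ :=
  Finset.univ.filter fun c => (∀ i, P i ≠ c) ∧ P j < c

theorem isEchelon_pivotMatrix_add {F α β κ : Type*} [Field F] [Fintype β] [Fintype κ]
    [DecidableEq β] [LinearOrder κ] {P : β → κ} (hP : Function.Injective P)
    {M : Matrix (α ⊕ β) κ F} (j₀ : β) (hM : ∀ i, ∀ c ∉ freePositions P j₀, M (Sum.inl i) c = 0)
    (hM' : ∀ j, ∀ c ∉ freePositions P j, M (Sum.inr j) c = 0) :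
    IsEchelon P (pivotMatrix F α P + M) where
  pivot i j := by
    simp [pivotMatrix, hM' i (P j) (by simp [freePositions]), hP.eq_iff]
  above i j := by
    simp [pivotMatrix, hM i (P j) (by simp [freePositions])]
  left i c hc := by
    simp [pivotMatrix, hM' i c (by simp [freePositions, hc.le]), hc.ne']

/-- Ferrers diagram codes of minimum rank distance `4` in echelon matrices with four pivots. -/
theorem exists_ferrersCode (F : Type*) [Field F] [Finite F] {n : ℕ} (P : Fin 4 → Fin n)
    (hP : StrictMono P) (hc : 6 ≤ (freePositions P 0).card) :
    ∃ D : Submodule F (Matrix (Fin 2 ⊕ Fin 4) (Fin n) F),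
      (∀ M ∈ D, M ≠ 0 → Module.finrank F (LinearMap.ker M.vecMulLinear) ≤ 2) ∧
      (∀ M ∈ D, IsEchelon P (pivotMatrix F (Fin 2) P + M)) ∧
      Nat.card D = Nat.card F ^ ((freePositions P 1).card + (freePositions P 2).card +
        (freePositions P 3).card) := by
  -- Three rows in `R` give kernels of dimension at most `2`, that is rank at least `4` among six
  -- rows. The rows outside `R` must allow the full support, which holds for the row of the first
  -- pivot.
  let R : Finset (Fin 2 ⊕ Fin 4) := {Sum.inr 1, Sum.inr 2, Sum.inr 3}
  have hR : R.card = 3 := rfl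
  obtain ⟨D, h1, h2, h3⟩ := exists_rankCode (F := F) (freePositions P 0) (by simpa using hc) R
    ⟨Sum.inr 1, by decide⟩ (Sum.elim (fun _ : Fin 2 => freePositions P 0) (freePositions P))
    (by
      rintro (i | j)
      · exact subset_rfl
      · intro c
        simp only [freePositions, Sum.elim_inr, Finset.mem_filter, Finset.mem_univ, true_and]
        exact fun h => ⟨h.1, (hP.monotone (Fin.zero_le j)).trans_lt h.2⟩)
    (by
      rintro (i | j) hr
      · rfl
      · have : j = 0 := by
          revert hr
          fin_cases j <;> decide
        rw [this]
        rfl)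
  refine ⟨D, fun M hM hne => ?_, fun M hM => ?_, ?_⟩
  · have := h1 M hM hne
    omega
  · exact isEchelon_pivotMatrix_add hP.injective 0 (fun i => h2 M hM (Sum.inl i))
      fun j => h2 M hM (Sum.inr j)
  · rw [h3]
    congr 1
    simp only [R]
    rw [Finset.sum_insert (by decide), Finset.sum_insert (by decide), Finset.sum_singleton,
      add_assoc]
    rfl

theorem finrank_comap_inl_inf_comap_inr_le {F α β : Type*} [Field F] [Finite α] [Finite β]
    (X : Submodule F (α → F)) (Z : Submodule F (β → F)) :
    Module.finrank F (X.comap (LinearMap.funLeft F F Sum.inl) ⊓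
      Z.comap (LinearMap.funLeft F F Sum.inr) : Submodule F (α ⊕ β → F)) ≤
      Module.finrank F X + Module.finrank F Z := by
  rw [← Module.finrank_prod]
  let Y := X.comap (LinearMap.funLeft F F (Sum.inl : α → α ⊕ β)) ⊓
      Z.comap (LinearMap.funLeft F F Sum.inr)
  let φ : Y →ₗ[F] X × Z :=
    ((LinearMap.funLeft F F Sum.inl ∘ₗ Y.subtype).codRestrict X fun c => c.2.1).prod
      ((LinearMap.funLeft F F Sum.inr ∘ₗ Y.subtype).codRestrict Z fun c => c.2.2)
  refine LinearMap.finrank_le_finrank_of_injective (f := φ) ?_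
  intro c d h
  have h1 := congrArg (fun x => (x.1 : α → F)) h
  have h2 := congrArg (fun x => (x.2 : β → F)) h
  apply Subtype.ext
  funext x
  rcases x with i | j
  · exact congrFun h1 i
  · exact congrFun h2 j

/-! ### The codewords with pivots 4, 5, 6, 7 -/

/-- The echelon matrix with pivots at the positions `4, 5, 6, 7`, the matrix `A` to the right of
the pivots, and the vector `y` above and to their left. -/
def middleMatrix {F : Type*} [Field F] (A : Matrix (Fin 4) (Fin 4) F) (y : Fin 4 → F) :
    Matrix (Fin 2 ⊕ Fin 4) (Fin 12) F :=
  Matrix.of (Sum.elim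
    (fun i c => if h : (c : ℕ) < 4 then if i = 0 then y ⟨c, h⟩ else 0 else 0)
    (fun j c => if 8 ≤ (c : ℕ) then A j ⟨(c : ℕ) - 8, by omega⟩ else
      if (c : ℕ) = 4 + j then 1 else 0))

theorem isEchelon_middleMatrix {F : Type*} [Field F] (A : Matrix (Fin 4) (Fin 4) F)
    (y : Fin 4 → F) : IsEchelon ![4, 5, 6, 7] (middleMatrix A y) where
  pivot i j := by
    fin_cases i <;> fin_cases j <;> simp [middleMatrix]
  above i j := by
    fin_cases j <;> simp [middleMatrix]
  left i c hc := by
    have h : (c : ℕ) < 4 + i := by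
      revert hc
      fin_cases i <;> simp [Fin.lt_def]
    have : (i : ℕ) < 4 := i.2
    simp only [middleMatrix, Matrix.of_apply, Sum.elim_inr]
    rw [if_neg (by omega), if_neg (by omega)]

theorem vecMul_middleMatrix_left {F : Type*} [Field F] (A : Matrix (Fin 4) (Fin 4) F)
    (y : Fin 4 → F) (c : Fin 2 ⊕ Fin 4 → F) (k : Fin 4) :
    (c ᵥ* middleMatrix A y) ⟨k, by omega⟩ = c (Sum.inl 0) * y k := by
  have h : ∀ j : Fin 4, ((k : ℕ) = 4 + j) = False := fun j => by simp; omega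
  have h8 : ¬ 8 ≤ (k : ℕ) := by omega
  simp [Matrix.vecMul, dotProduct, Fintype.sum_sum_type, middleMatrix, h, h8]

theorem vecMul_middleMatrix_right {F : Type*} [Field F] (A : Matrix (Fin 4) (Fin 4) F)
    (y : Fin 4 → F) (c : Fin 2 ⊕ Fin 4 → F) (k : Fin 4) :
    (c ᵥ* middleMatrix A y) ⟨8 + k, by omega⟩ = ((fun j => c (Sum.inr j)) ᵥ* A) k := by
  simp [Matrix.vecMul, dotProduct, Fintype.sum_sum_type, middleMatrix]
  intro h
  omega

/-- The `α` and `β` coefficients of a common vector are bounded by a sum that is always at most `2`.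
If `z ≠ z'` it is `0 + 2`, since the spread elements are disjoint. If only `z = z'` it is `1 + 1`,
since the left entries `y ≠ y'` kill the first `α` coefficient. If `z = z'` and `y = y'` it is `2 +
0`, since `A a` is then invertible. -/
theorem middleMatrix_inter_bounds {F V : Type*} [Field F] [AddCommGroup V] [Module F V]
    {A : (Fin 3 → Fin 4 → F) →ₗ[F] Matrix (Fin 4) (Fin 4) F}
    (hA : ∀ a ≠ 0, ∀ k : ℕ, k ≤ 3 → (∀ i : Fin 3, k ≤ i → a i = 0) →
        Module.finrank F (LinearMap.ker (A a).vecMulLinear) < k)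
    {W W' : (Fin 2 → F) →ₗ[F] V} {x y z x' y' z' : Fin 4 → F}
    (hW : z = z' → W = W' ∧ Function.Injective W)
    (hW' : z ≠ z' → ∀ a b, W a = W' b → a = 0 ∧ b = 0)
    (hne : (x, y, z) ≠ (x', y', z')) :
    Module.finrank F (LinearMap.range (blockMap W (middleMatrix (A ![x, y, z]) y)) ⊓
      LinearMap.range (blockMap W' (middleMatrix (A ![x', y', z']) y')) :
      Submodule F (V × (Fin 12 → F))) ≤ 2 := by
  set a : Fin 3 → Fin 4 → F := ![x, y, z] - ![x', y', z'] with ha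
  have ha0 : a 0 = x - x' := rfl
  have ha1 : a 1 = y - y' := rfl
  have ha2 : a 2 = z - z' := rfl
  have hane : a ≠ 0 := by
    intro h
    refine hne ?_
    have h0 := congrFun h 0
    have h1 := congrFun h 1
    have h2 := congrFun h 2
    rw [ha0] at h0
    rw [ha1] at h1
    rw [ha2] at h2
    rw [sub_eq_zero.1 h0, sub_eq_zero.1 h1, sub_eq_zero.1 h2]
  -- Here `X` bounds the `α` part; the `β` part lies in the kernel of `A a` because the last four
  -- columns of both matrices agree on it.
  have key : ∀ X : Submodule F (Fin 2 → F),
      Module.finrank F X + Module.finrank F (LinearMap.ker (A a).vecMulLinear) ≤ 2 →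
      (∀ c d : Fin 2 → F, W c = W' d → (y ≠ y' → c = d → c 0 = 0) → c ∈ X) →
      Module.finrank F (LinearMap.range (blockMap W (middleMatrix (A ![x, y, z]) y)) ⊓
        LinearMap.range (blockMap W' (middleMatrix (A ![x', y', z']) y')) :
        Submodule F (V × (Fin 12 → F))) ≤ 2 := by
    intro X hX hmem
    refine le_trans ?_ hX
    refine le_trans ?_ (finrank_comap_inl_inf_comap_inr_le X _)
    refine finrank_inf_blockMap_same (isEchelon_middleMatrix _ _) (isEchelon_middleMatrix _ _) _ ?_
    intro c d h1 h2 h3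
    refine ⟨hmem _ _ h1 ?_, ?_⟩
    · intro hy hcd
      obtain ⟨k, hk⟩ := Function.ne_iff.1 hy
      have h4 := congrFun h3 ⟨k, by omega⟩
      rw [vecMul_middleMatrix_left, vecMul_middleMatrix_left, ← congrFun hcd 0] at h4
      by_contra h0
      exact hk (mul_left_cancel₀ h0 h4)
    · change (fun j => c (Sum.inr j)) ᵥ* A a = 0
      funext k
      have h4 := congrFun h3 ⟨8 + k, by omega⟩
      rw [vecMul_middleMatrix_right, vecMul_middleMatrix_right, ← funext h2] at h4
      rw [ha, map_sub, Matrix.vecMul_sub, Pi.sub_apply, h4, sub_self, Pi.zero_apply]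
  by_cases hz : z = z'
  · obtain ⟨rfl, hinj⟩ := hW hz
    by_cases hy : y = y'
    · have h1 := hA a hane 1 (by omega) (by
        intro i hi
        fin_cases i
        · simp at hi
        · simp [ha1, hy]
        · simp [ha2, hz])
      refine key ⊤ ?_ fun _ _ _ _ => Submodule.mem_top
      simp only [finrank_top, Module.finrank_fin_fun]
      omega
    · have h1 := hA a hane 2 (by omega) (by
        intro i hi
        fin_cases i
        · simp at hi
        · simp at hi
        · simp [ha2, hz])
      refine key (LinearMap.ker (LinearMap.proj 0)) ?_ fun c d h h' => h' hy (hinj h)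
      have h2 := LinearMap.finrank_range_add_finrank_ker
        (LinearMap.proj 0 : (Fin 2 → F) →ₗ[F] F)
      rw [LinearMap.range_eq_top.2 (LinearMap.proj_surjective 0)] at h2
      simp only [finrank_top, Module.finrank_self, Module.finrank_fin_fun] at h2
      omega
  · have h1 := hA a hane 3 le_rfl (fun i hi => absurd i.2 (by omega))
    refine key ⊥ ?_ fun c d h _ => (hW' hz c d h).1
    simp only [finrank_bot]
    omega

/-! ### The pivot sets and their verification -/

/-- Seventeen quadruples that pairwise meet in at most two points: the blocks of the Steiner system
`S(3, 4, 8)` on `{0, …, 7}` other than `{4, 5, 6, 7}`, and four blocks with two points in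
`{8, …, 11}`. -/
def pivotTable : Fin 17 → Fin 4 → Fin 12 :=
  ![![0, 1, 2, 3], ![0, 1, 4, 5], ![2, 3, 6, 7], ![2, 3, 4, 5], ![0, 1, 6, 7], ![0, 2, 4, 6],
    ![1, 3, 5, 7], ![1, 2, 5, 6], ![0, 3, 4, 7], ![1, 3, 4, 6], ![0, 2, 5, 7], ![1, 2, 4, 7],
    ![0, 3, 5, 6], ![0, 1, 8, 9], ![2, 3, 8, 9], ![0, 2, 8, 10], ![1, 3, 8, 10]]

/-- The spread element used for each quadruple: only disjoint quadruples share one. The first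
quadruple uses a spread element that is also used for `{4, 5, 6, 7}`. -/
def spreadLabel : Fin 17 → Option (Fin 10) :=
  ![none, some 0, some 0, some 1, some 1, some 2, some 2, some 3, some 3, some 4, some 4,
    some 5, some 5, some 6, some 7, some 8, some 9]

/-- The common values of two families of pivots. -/
def commonPivots (P P' : Fin 4 → Fin 12) : Finset (Fin 12) :=
  Finset.univ.filter fun c => (∃ i, P i = c) ∧ ∃ j, P' j = c

theorem pivotTable_strictMono : ∀ k, StrictMono (pivotTable k) := by
  simp only [Fin.strictMono_iff_lt_succ]
  decide

theorem pivotTable_six_le : ∀ k, 6 ≤ (freePositions (pivotTable k) 0).card := by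
  decide

theorem pivotTable_exponent : ∀ k, (freePositions (pivotTable k) 1).card +
    (freePositions (pivotTable k) 2).card + (freePositions (pivotTable k) 3).card =
    (![24, 20, 14, 18, 16, 18, 15, 17, 16, 17, 16, 17, 16, 12, 10, 10, 9] : Fin 17 → ℕ) k := by
  decide

theorem pivotTable_pair : ∀ k l, k ≠ l →
    (∀ i j, pivotTable k i ≠ pivotTable l j) ∨
      ((commonPivots (pivotTable k) (pivotTable l)).card ≤ 2 ∧ spreadLabel k ≠ spreadLabel l) := by
  decide +kernel

theorem pivotTable_middle : ∀ k,
    (∀ i j, pivotTable k i ≠ (![4, 5, 6, 7] : Fin 4 → Fin 12) j) ∨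
      ((commonPivots (pivotTable k) ![4, 5, 6, 7]).card ≤ 2 ∧ spreadLabel k ≠ none) := by
  decide +kernel

theorem finrank_inf_blockMap_le_two {F V : Type*} [Field F] [AddCommGroup V] [Module F V]
    {P P' : Fin 4 → Fin 12} {N N' : Matrix (Fin 2 ⊕ Fin 4) (Fin 12) F} (hN : IsEchelon P N)
    (hN' : IsEchelon P' N') {W W' : (Fin 2 → F) →ₗ[F] V} (hW : Function.Injective W)
    (hW' : Function.Injective W')
    (h : (∀ i j, P i ≠ P' j) ∨
      ((commonPivots P P').card ≤ 2 ∧ ∀ a b, W a = W' b → a = 0 ∧ b = 0)) :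
    Module.finrank F ((LinearMap.range (blockMap W N) ⊓ LinearMap.range (blockMap W' N') :
      Submodule F (V × (Fin 12 → F)))) ≤ 2 := by
  rcases h with h | ⟨h, h'⟩
  · simpa using finrank_inf_blockMap_of_disjoint hN hN' hW hW' h
  · refine (finrank_inf_blockMap_le_card hN hN' h' _ fun i j hij => ?_).trans h
    simp only [commonPivots, Finset.mem_filter, Finset.mem_univ, true_and]
    exact ⟨⟨i, rfl⟩, ⟨j, hij.symm⟩⟩

/-- With equal spread map and pivots the two coefficient vectors coincide, so a common vector is a
relation among the rows of `M - M'`. -/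
theorem finrank_inf_blockMap_add {F V α β κ : Type*} [Field F] [Fintype α] [Fintype β]
    [DecidableEq β] [LinearOrder κ] [Finite κ] [AddCommGroup V] [Module F V] {P : β → κ}
    {B M M' : Matrix (α ⊕ β) κ F} (hM : IsEchelon P (B + M)) (hM' : IsEchelon P (B + M'))
    {W : (α → F) →ₗ[F] V} (hW : Function.Injective W) :
    Module.finrank F (LinearMap.range (blockMap W (B + M)) ⊓ LinearMap.range (blockMap W (B + M')) :
      Submodule F (V × (κ → F))) ≤ Module.finrank F (LinearMap.ker (M - M').vecMulLinear) := by
  refine finrank_inf_blockMap_same hM hM' _ fun c d h1 h2 h3 => ?_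
  have hcd : c = d := by
    funext i
    rcases i with i | j
    · exact congrFun (hW h1) i
    · exact h2 j
  subst hcd
  change c ᵥ* (M - M') = 0
  rw [Matrix.vecMul_add, Matrix.vecMul_add, add_right_inj] at h3
  rw [Matrix.vecMul_sub, h3, sub_self]

/-- Two codewords of echelon form whose matrices share two rows meet in dimension at least `2`. -/
theorem two_le_finrank_inf_blockMap {F V : Type*} [Field F] [AddCommGroup V] [Module F V]
    [Module.Finite F V] {P : Fin 4 → Fin 12} {N N' : Matrix (Fin 2 ⊕ Fin 4) (Fin 12) F}
    (hN : IsEchelon P N) {W W' : (Fin 2 → F) →ₗ[F] V} (hW : Function.Injective W)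
    (h0 : N (Sum.inr 0) = N' (Sum.inr 0)) (h1 : N (Sum.inr 1) = N' (Sum.inr 1)) :
    2 ≤ Module.finrank F ((LinearMap.range (blockMap W N) ⊓ LinearMap.range (blockMap W' N') :
      Submodule F (V × (Fin 12 → F)))) := by
  let ψ : (Fin 2 → F) →ₗ[F] (Fin 2 ⊕ Fin 4 → F) :=
    { toFun := fun d => Sum.elim 0 ![d 0, d 1, 0, 0]
      map_add' := fun x y => by
        ext (i | i)
        · simp
        · fin_cases i <;> simp
      map_smul' := fun t x => by
        ext (i | i)
        · simp
        · fin_cases i <;> simp }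
  have hψ : Function.Injective ψ := by
    intro x y h
    ext i
    fin_cases i
    · exact congrFun h (Sum.inr 0)
    · exact congrFun h (Sum.inr 1)
  have hmem : ∀ d, blockMap W N (ψ d) ∈
      (LinearMap.range (blockMap W N) ⊓ LinearMap.range (blockMap W' N') :
        Submodule F (V × (Fin 12 → F))) := by
    refine fun d => ⟨⟨_, rfl⟩, ⟨ψ d, ?_⟩⟩
    have hl : (fun i => ψ d (Sum.inl i)) = 0 := rfl
    rw [blockMap_apply, blockMap_apply, hl, map_zero, map_zero]
    congr 1
    funext c
    simp [Matrix.vecMul, dotProduct, Fintype.sum_sum_type, Fin.sum_univ_four, ψ, h0, h1]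
  have := LinearMap.finrank_le_finrank_of_injective
    (f := (blockMap W N ∘ₗ ψ).codRestrict _ hmem) (by
      intro x y h
      exact hψ (blockMap_injective hN hW (congrArg Subtype.val h)))
  simpa using this

/-! ### The family of added codewords -/

theorem exists_echelonFamily.{u} (F : Type u) [Field F] [Finite F] (Z : Finset (Fin 4 → F))
    (h0 : 0 ∈ Z) (hZ : Z.card + 10 ≤ Nat.card F ^ 4 + Nat.card F ^ 2 + 1) :
    ∃ (X : Type u) (W : X → ((Fin 2 → F) →ₗ[F] (Fin 6 → F)))
      (N : X → Matrix (Fin 2 ⊕ Fin 4) (Fin 12) F),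
      Finite X ∧ (∀ x, Function.Injective (W x)) ∧ (∀ x, ∃ P : Fin 4 → Fin 12, IsEchelon P (N x)) ∧
      (∀ x y, x ≠ y → Module.finrank F (LinearMap.range (blockMap (W x) (N x)) ⊓
        LinearMap.range (blockMap (W y) (N y)) :
          Submodule F ((Fin 6 → F) × (Fin 12 → F))) ≤ 2) ∧
      (∃ x y, x ≠ y ∧ 2 ≤ Module.finrank F (LinearMap.range (blockMap (W x) (N x)) ⊓
        LinearMap.range (blockMap (W y) (N y)) :
          Submodule F ((Fin 6 → F) × (Fin 12 → F)))) ∧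
      Nat.card X = (∑ k, Nat.card F ^
        (![24, 20, 14, 18, 16, 18, 15, 17, 16, 17, 16, 17, 16, 12, 10, 10, 9] : Fin 17 → ℕ) k) +
        Z.card * Nat.card F ^ 8 := by
  classical
  obtain ⟨T, hT, hT'⟩ := exists_spread F (Fin 6 → F) (r := 2) (m := 3) (by omega) (by omega)
    (by simp)
  -- Ten spread elements serve the labelled blocks and one more serves each `z ∈ Z`; `hZ` says that
  -- the spread is large enough.
  obtain ⟨lab⟩ : Nonempty (Fin 10 ⊕ Z ↪ Fin (∑ i ∈ Finset.range 3, (Nat.card F ^ 2) ^ i)) := by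
    rw [Function.Embedding.nonempty_iff_card_le]
    simp only [Fintype.card_sum, Fintype.card_fin, Fintype.card_coe, Finset.sum_range_succ,
      Finset.sum_range_zero, zero_add, ← pow_mul, mul_zero, mul_one, pow_zero, Nat.reduceMul]
    omega
  obtain ⟨A, hA⟩ := exists_flagCode F 4 3
  choose D hD hD' hDcard using fun k => exists_ferrersCode F (pivotTable k)
    (pivotTable_strictMono k) (pivotTable_six_le k)
  -- The block `{0, 1, 2, 3}` is disjoint from `{4, 5, 6, 7}`, so it can reuse the spread element of
  -- `z = 0`.
  let blockLab : Fin 17 → Fin 10 ⊕ Z := fun k =>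
    (spreadLabel k).elim (Sum.inr ⟨0, h0⟩) Sum.inl
  have blockLab_ne : ∀ k l, spreadLabel k ≠ spreadLabel l → blockLab k ≠ blockLab l := by
    intro k l h
    simp only [blockLab]
    rcases hk : spreadLabel k with _ | i <;> rcases hl : spreadLabel l with _ | j <;>
      simp_all
  have blockLab_ne' : ∀ k z, spreadLabel k ≠ none → blockLab k ≠ Sum.inr z := by
    intro k z h
    simp only [blockLab]
    rcases hk : spreadLabel k with _ | i <;> simp_all
  let X := (Σ k, D k) ⊕ (Z × (Fin 4 → F) × (Fin 4 → F))
  let l : X → Fin (∑ i ∈ Finset.range 3, (Nat.card F ^ 2) ^ i) := fun x =>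
    lab (Sum.elim (fun y => blockLab y.1) (fun y => Sum.inr y.1) x)
  let N : X → Matrix (Fin 2 ⊕ Fin 4) (Fin 12) F :=
    Sum.elim (fun y => pivotMatrix F (Fin 2) (pivotTable y.1) + y.2)
      (fun y => middleMatrix (A ![y.2.1, y.2.2, y.1]) y.2.2)
  let P : X → Fin 4 → Fin 12 := Sum.elim (fun y => pivotTable y.1) (fun _ => ![4, 5, 6, 7])
  have hN : ∀ x, IsEchelon (P x) (N x) := by
    rintro (⟨k, M⟩ | ⟨z, x, y⟩)
    · exact hD' k M M.2
    · exact isEchelon_middleMatrix _ _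
  have hsym : ∀ x y, Module.finrank F (LinearMap.range (blockMap (T (l x)) (N x)) ⊓
        LinearMap.range (blockMap (T (l y)) (N y)) :
          Submodule F ((Fin 6 → F) × (Fin 12 → F))) =
      Module.finrank F (LinearMap.range (blockMap (T (l y)) (N y)) ⊓
        LinearMap.range (blockMap (T (l x)) (N x)) :
          Submodule F ((Fin 6 → F) × (Fin 12 → F))) := by
    intro x y
    rw [inf_comm]
  have hmixed : ∀ (u : Σ k, D k) (v : Z × (Fin 4 → F) × (Fin 4 → F)),
      Module.finrank F (LinearMap.range (blockMap (T (l (Sum.inl u))) (N (Sum.inl u))) ⊓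
        LinearMap.range (blockMap (T (l (Sum.inr v))) (N (Sum.inr v))) :
          Submodule F ((Fin 6 → F) × (Fin 12 → F))) ≤ 2 := by
    intro u v
    refine finrank_inf_blockMap_le_two (hN _) (hN _) (hT _) (hT _) ?_
    exact (pivotTable_middle u.1).imp id fun h => ⟨h.1, hT' _ _ fun h' =>
      blockLab_ne' u.1 v.1 h.2 (lab.injective h')⟩
  have hsame : ∀ k (M M' : D k) t, M ≠ M' → Module.finrank F
      (LinearMap.range (blockMap (T t) (pivotMatrix F (Fin 2) (pivotTable k) + M.1)) ⊓
        LinearMap.range (blockMap (T t) (pivotMatrix F (Fin 2) (pivotTable k) + M'.1)) :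
          Submodule F ((Fin 6 → F) × (Fin 12 → F))) ≤ 2 := by
    intro k M M' t hne
    refine (finrank_inf_blockMap_add (hD' k M M.2) (hD' k M' M'.2) (hT t)).trans ?_
    exact hD k _ ((D k).sub_mem M.2 M'.2) (sub_ne_zero.2 fun h => hne (Subtype.ext h))
  refine ⟨X, fun x => T (l x), N, inferInstance, fun x => hT _, fun x => ⟨_, hN x⟩, ?_, ?_, ?_⟩
  · rintro (⟨k, M⟩ | ⟨z, x, y⟩) (⟨k', M'⟩ | ⟨z', x', y'⟩) hne
    · by_cases hk : k = k'
      · subst hk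
        exact hsame k M M' _ fun h => hne (by rw [h])
      · refine finrank_inf_blockMap_le_two (hN _) (hN _) (hT _) (hT _) ?_
        exact (pivotTable_pair k k' hk).imp id fun h => ⟨h.1, hT' _ _ fun h' =>
          blockLab_ne k k' h.2 (lab.injective h')⟩
    · exact hmixed _ _
    · rw [hsym]
      exact hmixed _ _
    · refine middleMatrix_inter_bounds hA ?_ ?_ ?_
      · intro h
        obtain rfl : z = z' := Subtype.ext h
        exact ⟨rfl, hT _⟩
      · intro h
        refine hT' _ _ fun h' => h ?_
        have := lab.injective h'
        simp only [Sum.elim_inr, Sum.inr.injEq] at this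
        rw [this]
      · intro h
        simp only [Prod.mk.injEq] at h
        obtain ⟨rfl, rfl, h⟩ := h
        exact hne (by rw [Subtype.ext h])
  -- The pivot sets `{0, 1, 2, 3}` and `{0, 1, 4, 5}` with zero filling share the unit rows at `0`
  -- and `1`.
  · refine ⟨Sum.inl ⟨0, 0⟩, Sum.inl ⟨1, 0⟩, ?_, ?_⟩
    · intro h
      exact absurd (congrArg Sigma.fst (Sum.inl.inj h)) (by simp)
    · refine two_le_finrank_inf_blockMap (hN _) (hT _) ?_ ?_
      · rfl
      · rfl
  · simp only [X, Nat.card_sum, Nat.card_sigma, Nat.card_prod, hDcard, pivotTable_exponent]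
    simp only [Nat.card_fun, Nat.card_eq_fintype_card, Fintype.card_coe, Fintype.card_fin]
    ring

/-! ### The code in `F ^ 18` -/

/-- Joining the first `k` and the last `m` coordinates. -/
def joinCoordinates (F : Type*) [Field F] {n k m : ℕ} (h : k + m = n) :
    ((Fin k → F) × (Fin m → F)) ≃ₗ[F] (Fin n → F) where
  toFun x j := if h : (j : ℕ) < k then x.1 ⟨j, h⟩ else x.2 ⟨(j : ℕ) - k, by omega⟩
  invFun y := (fun i => y ⟨i, by omega⟩, fun i => y ⟨k + i, by omega⟩)
  map_add' x y := by
    ext j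
    by_cases hj : (j : ℕ) < k <;> simp [hj]
  map_smul' c x := by
    ext j
    by_cases hj : (j : ℕ) < k <;> simp [hj]
  left_inv x := by
    ext i <;> simp
  right_inv y := by
    ext j
    by_cases hj : (j : ℕ) < k
    · simp [hj]
    · simp only [hj, dite_false]
      congr 1
      ext
      simp
      omega

theorem rowSpace_liftMatrix {F : Type*} [Field F] {n k : ℕ} (h : k + (n - k) = n)
    (A : Matrix (Fin k) (Fin (n - k)) F) :
    rowSpace (liftMatrix A) =
      (LinearMap.range (graphMap A)).map (joinCoordinates F h).toLinearMap := by
  rw [rowSpace, ← range_vecMulLinear, ← LinearMap.range_comp]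
  congr 1
  refine LinearMap.ext fun c => ?_
  ext j
  by_cases hj : (j : ℕ) < k
  · simp [Matrix.vecMul, dotProduct, liftMatrix, joinCoordinates, graphMap_apply, hj,
      Matrix.one_apply]
  · simp [Matrix.vecMul, dotProduct, liftMatrix, joinCoordinates, graphMap_apply, hj]

theorem rank_add_finrank_ker_vecMulLinear {F ρ κ : Type*} [Field F] [Fintype ρ] [Fintype κ]
    (M : Matrix ρ κ F) :
    M.rank + Module.finrank F (LinearMap.ker M.vecMulLinear) = Fintype.card ρ := by
  rw [← Matrix.rank_transpose, Matrix.rank, Matrix.mulVecLin_transpose,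
    LinearMap.finrank_range_add_finrank_ker, Module.finrank_fintype_fun_eq_card]

theorem exists_linearMRD (F : Type*) [Field F] [Finite F] {m n δ : ℕ} (h1 : 1 ≤ δ) (hm : δ ≤ m)
    (hn : m ≤ n) : ∃ D : Submodule F (Matrix (Fin m) (Fin n) F), IsLinearMRD δ D := by
  -- Any `m - δ + 1` rows will do: kernels then have dimension at most `m - δ`, and no support is
  -- restricted.
  obtain ⟨R, -, hR⟩ := Finset.exists_subset_card_eq
    (s := (Finset.univ : Finset (Fin m))) (n := m - δ + 1) (by simp; omega)
  obtain ⟨D, hD1, -, hD3⟩ := exists_rankCode (F := F) (ρ := Fin m) (Finset.univ : Finset (Fin n))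
    (by simpa using hn) R (Finset.card_pos.1 (by omega)) (fun _ => Finset.univ)
    (fun _ => subset_rfl) (fun _ _ => rfl)
  refine ⟨D, h1, by omega, fun A hA B hB hne => ?_, ?_⟩
  · have h2 := hD1 _ (D.sub_mem hA hB) (sub_ne_zero.2 hne)
    have h3 := rank_add_finrank_ker_vecMulLinear (A - B)
    rw [Fintype.card_fin] at h3
    omega
  · rw [hD3, max_eq_right hn, min_eq_left hn, Finset.sum_const, hR, Finset.card_univ,
      Fintype.card_fin, smul_eq_mul, mul_comm]

theorem injective_of_finrank_inf_lt {F V I : Type*} [Field F] [AddCommGroup V] [Module F V]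
    {k : ℕ} {U : I → Submodule F V} (hU : ∀ i, Module.finrank F (U i) = k)
    (hUU : ∀ i j, i ≠ j → Module.finrank F (U i ⊓ U j : Submodule F V) < k) :
    Function.Injective U := by
  intro i j h
  by_contra hne
  have := hUU i j hne
  rw [← h, inf_idem, hU i] at this
  exact this.false

/-- The bound `2` on intersections gives distance at least `8`; `hX2` shows that it is attained, as
the code is required to have minimum distance exactly `8`. -/
theorem card_mem_sizesWithLiftedMRD (F : Type*) [Field F] [Finite F] {X : Type*} [Finite X]
    (W : X → ((Fin 2 → F) →ₗ[F] (Fin 6 → F))) (N : X → Matrix (Fin 2 ⊕ Fin 4) (Fin 12) F)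
    (hW : ∀ x, Function.Injective (W x)) (hN : ∀ x, ∃ P : Fin 4 → Fin 12, IsEchelon P (N x))
    (hXX : ∀ x y, x ≠ y → Module.finrank F (LinearMap.range (blockMap (W x) (N x)) ⊓
        LinearMap.range (blockMap (W y) (N y)) :
          Submodule F ((Fin 6 → F) × (Fin 12 → F))) ≤ 2)
    (hX2 : ∃ x y, x ≠ y ∧ 2 ≤ Module.finrank F (LinearMap.range (blockMap (W x) (N x)) ⊓
        LinearMap.range (blockMap (W y) (N y)) :
          Submodule F ((Fin 6 → F) × (Fin 12 → F)))) :
    Nat.card F ^ 36 + Nat.card X ∈ sizesWithLiftedMRD F 18 8 6 := by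
  obtain ⟨D, hD⟩ := exists_linearMRD F (m := 6) (n := 12) (δ := 4) (by omega) (by omega) (by omega)
  let Φ : ((Fin 6 → F) × (Fin 12 → F)) ≃ₗ[F] (Fin 18 → F) :=
    joinCoordinates F (n := 18) (k := 6) (m := 12) rfl
  let B : D ⊕ X → Submodule F ((Fin 6 → F) × (Fin 12 → F)) :=
    Sum.elim (fun A => LinearMap.range (graphMap (A : Matrix (Fin 6) (Fin 12) F)))
      (fun x => LinearMap.range (blockMap (W x) (N x)))
  have hB : ∀ i, Module.finrank F (B i) = 6 := by
    rintro (A | x)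
    · exact (LinearMap.finrank_range_of_inj (graphMap_injective _)).trans
        (Module.finrank_fin_fun F)
    · obtain ⟨P, hP⟩ := hN x
      exact (LinearMap.finrank_range_of_inj (blockMap_injective hP (hW x))).trans
        (Module.finrank_fintype_fun_eq_card F)
  have hBB : ∀ i j, i ≠ j →
      Module.finrank F (B i ⊓ B j : Submodule F ((Fin 6 → F) × (Fin 12 → F))) ≤ 2 := by
    have hmixed : ∀ (A : D) (x : X), Module.finrank F (B (Sum.inl A) ⊓ B (Sum.inr x) :
        Submodule F ((Fin 6 → F) × (Fin 12 → F))) ≤ 2 := fun A x =>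
      finrank_inf_graphMap_blockMap_le (A : Matrix (Fin 6) (Fin 12) F) (W x) (N x)
    rintro (A | x) (A' | y) hne
    · refine (finrank_inf_graphMap_le _ _).trans ?_
      have h1 := hD.rank_sub A A.2 A' A'.2 fun h => hne (by rw [Subtype.ext h])
      have h2 := rank_add_finrank_ker_vecMulLinear (A - A' : Matrix (Fin 6) (Fin 12) F)
      rw [Fintype.card_fin] at h2
      omega
    · exact hmixed A y
    · rw [inf_comm]
      exact hmixed A' x
    · exact hXX x y fun h => hne (by rw [h])
  let U : D ⊕ X → Submodule F (Fin 18 → F) := fun i => (B i).map Φ.toLinearMap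
  have hU : ∀ i, Module.finrank F (U i) = 6 := fun i => by
    rw [← hB i]
    exact LinearEquiv.finrank_map_eq Φ (B i)
  have hUU : ∀ i j, Module.finrank F (U i ⊓ U j : Submodule F (Fin 18 → F)) =
      Module.finrank F (B i ⊓ B j : Submodule F ((Fin 6 → F) × (Fin 12 → F))) := fun i j => by
    change Module.finrank F ((B i).map Φ.toLinearMap ⊓ (B j).map Φ.toLinearMap :
      Submodule F (Fin 18 → F)) = _
    rw [← Submodule.map_inf _ Φ.injective]
    exact LinearEquiv.finrank_map_eq Φ _
  have hinj : Function.Injective U := injective_of_finrank_inf_lt hU fun i j hij => by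
    rw [hUU]
    exact (hBB i j hij).trans_lt (by omega)
  have hdist : ∀ i j, subspaceDist (U i) (U j) =
      12 - 2 * Module.finrank F (B i ⊓ B j : Submodule F ((Fin 6 → F) × (Fin 12 → F))) := by
    intro i j
    rw [subspaceDist, hU, hU, hUU]
  refine ⟨Set.range U, ⟨?_, ?_, ?_⟩, ⟨4, D, rfl, hD, ?_⟩, ?_⟩
  · rintro _ ⟨i, rfl⟩
    exact hU i
  · obtain ⟨x, y, hxy, h2⟩ := hX2
    have hne : (Sum.inr x : D ⊕ X) ≠ Sum.inr y := fun h => hxy (Sum.inr.inj h)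
    refine ⟨U (Sum.inr x), ⟨_, rfl⟩, U (Sum.inr y), ⟨_, rfl⟩, hinj.ne hne, ?_⟩
    have h1 := hBB _ _ hne
    have h2' : 2 ≤ Module.finrank F (B (Sum.inr x) ⊓ B (Sum.inr y) :
      Submodule F ((Fin 6 → F) × (Fin 12 → F))) := h2
    rw [hdist]
    omega
  · rintro e ⟨_, ⟨i, rfl⟩, _, ⟨j, rfl⟩, hij, rfl⟩
    have h1 := hBB i j fun h => hij (by rw [h])
    rw [hdist]
    omega
  · rintro _ ⟨A, hA, rfl⟩
    exact ⟨Sum.inl ⟨A, hA⟩, (rowSpace_liftMatrix (n := 18) (k := 6) rfl A).symm⟩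
  · rw [← Nat.card_coe_set_eq, Nat.card_range_of_injective hinj, Nat.card_sum, hD.card_eq]
    rfl

/-! ### The numerical bounds -/

theorem le_Abar_of_finset (F : Type*) [Field F] [Finite F] (Z : Finset (Fin 4 → F)) (h0 : 0 ∈ Z)
    (hZ : Z.card + 10 ≤ Nat.card F ^ 4 + Nat.card F ^ 2 + 1) :
    Nat.card F ^ 36 + ((∑ k, Nat.card F ^
        (![24, 20, 14, 18, 16, 18, 15, 17, 16, 17, 16, 17, 16, 12, 10, 10, 9] : Fin 17 → ℕ) k) +
        Z.card * Nat.card F ^ 8) ≤ Abar F 18 8 6 := by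
  obtain ⟨X, W, N, hX, hW, hN, hXX, hX2, hcard⟩ := exists_echelonFamily F Z h0 hZ
  rw [← hcard]
  exact le_csSup (bddAbove_sizesWithLiftedMRD F 18 8 6)
    (card_mem_sizesWithLiftedMRD F W N hW hN hXX hX2)

theorem corollary3p4 (F : Type*) [Field F] [Finite F] (q : ℕ) (hq : Nat.card F = q) :
    (2 < q →
      q ^ 36 + q ^ 24 + q ^ 20 + 2 * q ^ 18 + 3 * q ^ 17 + 4 * q ^ 16 + q ^ 15 + q ^ 14
        + 2 * q ^ 12 + 2 * q ^ 10 + 2 * q ^ 8 + q ^ 7 + q ^ 6 + 2 * q ^ 4 + q ^ 2 + 1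
      ≤ Abar F 18 8 6) ∧
    (q = 2 →
      q ^ 36 + q ^ 24 + q ^ 20 + 2 * q ^ 18 + 3 * q ^ 17 + q ^ 16 + q ^ 14
        + 2 * q ^ 12 + 2 * q ^ 10 + 2 * q ^ 8 + q ^ 7 + q ^ 6 + 2 * q ^ 4 + q ^ 2 + 1
      ≤ Abar F 18 8 6) := by
  classical
  have := Fintype.ofFinite F
  constructor
  · intro h
    have hcard : (Finset.univ : Finset (Fin 4 → F)).card = q ^ 4 := by
      simp [← hq, Nat.card_eq_fintype_card]
    -- Taking all `z` needs `q ^ 4 + 10 ≤ q ^ 4 + q ^ 2 + 1`, that is `q ≥ 3`, with equality at `q =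
    -- 3`.
    have h2 : 3 ^ 2 ≤ q ^ 2 := Nat.pow_le_pow_left h 2
    refine le_trans ?_ (le_Abar_of_finset F Finset.univ (Finset.mem_univ _)
      (by rw [hcard, hq]; omega))
    rw [hcard, hq]
    -- The construction has a term `q ^ 9` that the claim lacks; for `q ≥ 3` it dominates the
    -- claimed tail from `2 * q ^ 8` downwards.
    have h3 : ∀ n, 3 * q ^ n ≤ q ^ (n + 1) := fun n => by
      rw [pow_succ, mul_comm]
      exact Nat.mul_le_mul_left _ h
    have e2 : 3 * q ^ 2 ≤ q ^ 3 := h3 2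
    have e3 : 3 * q ^ 3 ≤ q ^ 4 := h3 3
    have e4 : 3 * q ^ 4 ≤ q ^ 5 := h3 4
    have e5 : 3 * q ^ 5 ≤ q ^ 6 := h3 5
    have e6 : 3 * q ^ 6 ≤ q ^ 7 := h3 6
    have e7 : 3 * q ^ 7 ≤ q ^ 8 := h3 7
    have e8 : 3 * q ^ 8 ≤ q ^ 9 := h3 8
    have e12 : q ^ 4 * q ^ 8 = q ^ 12 := by ring
    simp only [Fin.sum_univ_succ, Fin.sum_univ_zero, Matrix.cons_val_zero, Matrix.cons_val_succ,
      e12]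
    omega
  · intro h
    -- For `q = 2` the spread is too small for all `z`, but the claim omits `3 * q ^ 16 + q ^ 15`,
    -- so a single `z` is enough.
    refine le_trans ?_ (le_Abar_of_finset F {0} (Finset.mem_singleton_self _)
      (by rw [hq, h, Finset.card_singleton]; norm_num))
    rw [hq, h]
    simp [Fin.sum_univ_succ]
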